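/- **Conventions.** A *pointed $\omega$-cpo* is a partially ordered set with a least element $\bot$ in which every $\omega$-chain has a least upper bound. An *$\omega\mathbf{Cpo}_\bot$-enriched category* is a category $\mathcal C$ whose hom-sets are pointed $\omega$-cpos and whose composition is jointly $\omega$-continuous (in particular monotone) and satisfies $g\circ\bot=\bot$ and $\bot\circ f=\bot$. It has *finite $\omega\mathbf{Cpo}_\bot$-coproducts* if it has (chosen) finite coproducts $\mathsf 0$, $B\sqcup A$ such that the copairing bijections $\mathcal C(B,K)\times\mathcal C(A,K)\to\mathcal C(B\sqcup A,K)$ are isomorphisms of posets. An *iterative category* $(\mathcal C,\mathrm{iter})$ is a category with chosen finite coproducts and a family of functions $\mathrm{iter}^{(A,B)}:\mathcal C(A,B\sqcup A)\to\mathcal C(A,B)$; a morphism of iterative categories is a functor that strictly preserves the finite coproducts and the functions $\mathrm{iter}$. If $\mathcal C$ is $\omega\mathbf{Cpo}_\bot$-enriched with finite $\omega\mathbf{Cpo}_\bot$-coproducts, its *enriched iteration* is, for $f:A\to B\sqcup A$, $$\mathrm{iter}_\omega f=\Bigl(\bigsqcup_{n\ge 1}\,[\mathrm{id}_B,\bot]\circ[\iota_B,f]^n\Bigr)\circ\iota_A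 .$$ An *$\omega\mathbf{Cpo}_\bot$-finite-coproduct-extensive indexed category* is a pair $(\mathcal C,\mathcal L)$ in which $\mathcal C$ is an $\omega\mathbf{Cpo}_\bot$-enriched category with finite $\omega\mathbf{Cpo}_\bot$-coproducts and $\mathcal L:\mathcal C^{op}\to\mathbf{CAT}$ is a (strict) functor, together with natural transformations $\mathcal L(f\le g):\mathcal L(f)\to\mathcal L(g)$ for all $f\le g$ in $\mathcal C(A,B)$ that make $\mathcal L$ a 2-functor, such that: every $\mathcal L(A)$ has an initial object and colimits of $\omega$-chains; every functor $\mathcal C(A,B)\to\mathbf{CAT}(\mathcal L(B),\mathcal L(A))$ preserves initial objects and colimits of $\omega$-chains; and $\mathcal L$ preserves finite products, i.e. $\mathcal L(\mathsf 0)\cong\mathbf 1$ and the comparison functors $\mathcal L(B\sqcup A)\to\mathcal L(B)\times\mathcal L(A)$ are isomorphisms of categories, with inverses $\mathcal S^{(B,A)}$. The *op-Grothendieck construction* $\Sigma_{\mathcal C}\mathcal L^{op}$ has as objects the pairs $(A,X)$ with $A\in\mathcal C$, $X\in\mathcal L(A)$; a morphism $(A,X)\to(B,Y)$ is a pair $(f,f')$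 with $f:A\to B$ in $\mathcal C$ and $f':\mathcal L(f)(Y)\to X$ in $\mathcal L(A)$; and $(g,g')\circ(f,f')=(g\circ f,\ f'\circ\mathcal L(f)(g'))$. Its finite coproducts are $(\mathsf 0,\ast)$, where $\ast$ is the only object of $\mathcal L(\mathsf 0)$, and $(B,Y)\sqcup(A,X)=(B\sqcup A,\mathcal S^{(B,A)}(Y,X))$. It is $\omega\mathbf{Cpo}_\bot$-enriched by $$(f,f')\le(g,g')\iff f\le g\ \text{ and }\ f'=g'\circ\mathcal L(f\le g)_Y ;$$ the least element of a hom-set is $\bot$ with the unique morphism out of the initial object $\mathcal L(\bot)(Y)$, and the least upper bound of a chain $(g_n,g_n')_n$ is $(\bigsqcup_n g_n,g')$, with $g'$ induced by the $g_n'$ and the colimit $\mathcal L(\bigsqcup_n g_n)(Y)\cong\mathrm{colim}_n\,\mathcal L(g_n)(Y)$. With these data its finite coproducts are $\omega\mathbf{Cpo}_\bot$-coproducts, so it carries an enriched iteration $\mathrm{iter}_\omega$ (the *concrete $\omega\mathbf{Cpo}_\bot$-container iteration*). The *underlying iteration-extensive indexed category* of $(\mathcal C,\mathcal L)$ is $(\mathcal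 C,\mathrm{iter},\mathcal L)$, where $\mathrm{iter}$ is the enriched iteration of $\mathcal C$: for each $f:A\to B\sqcup A$ the parameterized initial algebra of $H_f=\mathcal L(f)\circ\mathcal S^{(B,A)}:\mathcal L(B)\times\mathcal L(A)\to\mathcal L(A)$ exists and is identified with $\mathcal L(\mathrm{iter} f):\mathcal L(B)\to\mathcal L(A)$ through the canonical natural isomorphism, under which the initial $H_f(Y,-)$-algebra structure on $\mathcal L(\mathrm{iter} f)(Y)$ is the identity $\mathcal L(f)\mathcal S^{(B,A)}(Y,\mathcal L(\mathrm{iter} f)(Y))=\mathcal L(\mathrm{iter} f)(Y)$. The *container iteration* $\widehat{\mathrm{iter}}$ on $\Sigma_{\mathcal C}\mathcal L^{op}$ that it induces sends $(f,f'):(A,X)\to(B,Y)\sqcup(A,X)$ to $(\mathrm{iter} f,\ \mathrm{fold}(f'))$, where $\mathrm{fold}(f'):\mathcal L(\mathrm{iter} f)(Y)\to X$ is the unique morphism of $H_f(Y,-)$-algebras from the initial algebra to $(X,\ f':\mathcal L(f)\mathcal S^{(B,A)}(Y,X)\to X)$. **Theorem.** Let $(\mathcal C,\mathcal L)$ be an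 $\omega\mathbf{Cpo}_\bot$-finite-coproduct-extensive indexed category. Then the container iteration $\widehat{\mathrm{iter}}$ on $\Sigma_{\mathcal C}\mathcal L^{op}$ induced by the underlying iteration-extensive indexed category $(\mathcal C,\mathrm{iter},\mathcal L)$ coincides with the concrete $\omega\mathbf{Cpo}_\bot$-container iteration $\mathrm{iter}_\omega$. In other words, the identity functor on $\Sigma_{\mathcal C}\mathcal L^{op}$ is an isomorphism of iterative categories $$\bigl(\Sigma_{\mathcal C}\mathcal L^{op},\widehat{\mathrm{iter}}\bigr)\longrightarrow\bigl(\Sigma_{\mathcal C}\mathcal L^{op},\mathrm{iter}_\omega\bigr).$$ -/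

import Mathlib

open CategoryTheory CategoryTheory.Limits Opposite OmegaCompletePartialOrder

attribute [-instance] CategoryTheory.catToReflQuiver

universe v u v₁ u₁ v₂ u₂ v₃ u₃

namespace IterCat

section Coproducts

/-- A choice of finite coproducts: an initial object and binary coproducts. -/
class ChosenFiniteCoproducts (C : Type u) [Category.{v} C] where
  zero : C
  zeroIsInitial : IsInitial zero
  sum : C → C → C
  inl (A B : C) : A ⟶ sum A B
  inr (A B : C) : B ⟶ sum A B
  isColimit (A B : C) : IsColimit (BinaryCofan.mk (inl A B) (inr A B))

open ChosenFiniteCoproducts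

variable {C : Type u} [Category.{v} C] [ChosenFiniteCoproducts C]

/-- The copairing `[f, g]`. -/
def desc {A B K : C} (f : A ⟶ K) (g : B ⟶ K) : sum A B ⟶ K :=
  (isColimit A B).desc (BinaryCofan.mk f g)

@[simp]
theorem inl_desc {A B K : C} (f : A ⟶ K) (g : B ⟶ K) : inl A B ≫ desc f g = f :=
  (isColimit A B).fac (BinaryCofan.mk f g) ⟨WalkingPair.left⟩

@[simp]
theorem inr_desc {A B K : C} (f : A ⟶ K) (g : B ⟶ K) : inr A B ≫ desc f g = g :=
  (isColimit A B).fac (BinaryCofan.mk f g) ⟨WalkingPair.right⟩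

@[simp]
theorem inl_desc_assoc {A B K K' : C} (f : A ⟶ K) (g : B ⟶ K) (h : K ⟶ K') :
    inl A B ≫ desc f g ≫ h = f ≫ h := by
  rw [← Category.assoc, inl_desc]

@[simp]
theorem inr_desc_assoc {A B K K' : C} (f : A ⟶ K) (g : B ⟶ K) (h : K ⟶ K') :
    inr A B ≫ desc f g ≫ h = g ≫ h := by
  rw [← Category.assoc, inr_desc]

theorem sum_hom_ext {A B K : C} {h h' : sum A B ⟶ K} (hl : inl A B ≫ h = inl A B ≫ h')
    (hr : inr A B ≫ h = inr A B ≫ h') : h = h' :=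
  BinaryCofan.IsColimit.hom_ext (isColimit A B) hl hr

variable (C) in
/-- A (raw, context-free) iteration: a family of functions `C(A, B ⊔ A) → C(A, B)`. -/
def Iteration : Type (max u v) := ∀ A B : C, (A ⟶ sum B A) → (A ⟶ B)

end Coproducts

/-! ### The category of iterative categories -/

open ChosenFiniteCoproducts

/-- An iterative category: a category with finite coproducts and a (raw) iteration. -/
structure IterativeCategory where
  carrier : Type u
  [category : Category.{v} carrier]
  [coproducts : ChosenFiniteCoproducts carrier]
  iter : Iteration carrier

attribute [instance] IterativeCategory.category IterativeCategory.coproducts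

/-- An iterative category morphism: a functor that strictly preserves finite coproducts
and iteration. -/
structure IterativeFunctor (P Q : IterativeCategory.{v, u}) where
  functor : P.carrier ⥤ Q.carrier
  map_zero : functor.obj zero = zero
  map_sum (A B : P.carrier) : functor.obj (sum A B) = sum (functor.obj A) (functor.obj B)
  map_inl (A B : P.carrier) :
    functor.map (inl A B) ≫ eqToHom (map_sum A B) = inl (functor.obj A) (functor.obj B)
  map_inr (A B : P.carrier) :
    functor.map (inr A B) ≫ eqToHom (map_sum A B) = inr (functor.obj A) (functor.obj B)
  map_iter (A B : P.carrier) (g : A ⟶ sum B A) :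
    Q.iter (functor.obj A) (functor.obj B) (functor.map g ≫ eqToHom (map_sum B A)) =
      functor.map (P.iter A B g)

namespace IterativeFunctor

theorem ext_functor {P Q : IterativeCategory.{v, u}} {F G : IterativeFunctor P Q}
    (h : F.functor = G.functor) : F = G := by
  cases F; cases G; cases h; rfl

/-- The identity morphism of an iterative category. -/
def id (P : IterativeCategory.{v, u}) : IterativeFunctor P P where
  functor := 𝟭 _
  map_zero := rfl
  map_sum _ _ := rfl
  map_inl _ _ := by simp
  map_inr _ _ := by simp
  map_iter _ _ _ := by simp

/-- Composition of iterative category morphisms. -/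
def comp {P Q R : IterativeCategory.{v, u}} (F : IterativeFunctor P Q)
    (G : IterativeFunctor Q R) : IterativeFunctor P R where
  functor := F.functor ⋙ G.functor
  map_zero := by rw [Functor.comp_obj, F.map_zero, G.map_zero]
  map_sum A B := by rw [Functor.comp_obj, F.map_sum, G.map_sum]; rfl
  map_inl A B := by
    have h := congrArg G.functor.map (F.map_inl A B)
    rw [Functor.map_comp, eqToHom_map] at h
    dsimp only [Functor.comp_map, Functor.comp_obj]
    rw [← G.map_inl, ← h]; simp
  map_inr A B := by
    have h := congrArg G.functor.map (F.map_inr A B)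
    rw [Functor.map_comp, eqToHom_map] at h
    dsimp only [Functor.comp_map, Functor.comp_obj]
    rw [← G.map_inr, ← h]; simp
  map_iter A B g := by
    dsimp only [Functor.comp_map, Functor.comp_obj]
    rw [← F.map_iter, ← G.map_iter, Functor.map_comp, eqToHom_map]
    simp

end IterativeFunctor

/-- Iterative categories and their morphisms form a category. -/
instance : Category IterativeCategory.{v, u} where
  Hom := IterativeFunctor
  id := IterativeFunctor.id
  comp := IterativeFunctor.comp
  id_comp _ := IterativeFunctor.ext_functor rfl
  comp_id _ := IterativeFunctor.ext_functor rfl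
  assoc _ _ _ := IterativeFunctor.ext_functor rfl

/-! ### Enrichment in pointed ω-cpos and the induced iteration -/

/-- A category enriched in pointed ω-cpos (with the smash product): every hom-set is a pointed
ω-cpo and composition is jointly ω-continuous and strict in each argument. -/
class OmegaCpoCategory (C : Type u) [Category.{v} C] where
  homOrder (A B : C) : OmegaCompletePartialOrder (A ⟶ B)
  homBot (A B : C) : OrderBot (A ⟶ B)
  comp_continuous (A B K : C) :
    ωScottContinuous (fun p : (A ⟶ B) × (B ⟶ K) => p.1 ≫ p.2)
  bot_comp {A B K : C} (g : B ⟶ K) : (⊥ : A ⟶ B) ≫ g = ⊥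
  comp_bot {A B K : C} (f : A ⟶ B) : f ≫ (⊥ : B ⟶ K) = ⊥

attribute [reducible, instance] OmegaCpoCategory.homOrder OmegaCpoCategory.homBot

/-- The chosen finite coproducts are enriched coproducts: copairing is monotone, so that the
bijection `C(A ⊔ B, K) ≃ C(A, K) × C(B, K)`, whose inverse is copairing, is an isomorphism of
pointed ω-cpos. (For the initial object the corresponding condition is empty.) -/
class OmegaCpoCoproducts (C : Type u) [Category.{v} C] [OmegaCpoCategory C]
    [ChosenFiniteCoproducts C] : Prop where
  desc_mono {A B K : C} {f f' : A ⟶ K} {g g' : B ⟶ K} :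
    f ≤ f' → g ≤ g' → desc f g ≤ desc f' g'

section Enriched

variable {C : Type u} [Category.{v} C] [OmegaCpoCategory C]

theorem comp_le_comp {A B K : C} {f f' : A ⟶ B} {g g' : B ⟶ K} (hf : f ≤ f') (hg : g ≤ g') :
    f ≫ g ≤ f' ≫ g' :=
  (OmegaCpoCategory.comp_continuous A B K).monotone (Prod.mk_le_mk.2 ⟨hf, hg⟩)

theorem isLUB_comp_ωSup {A B K : C} (f : A ⟶ B) (c : Chain (B ⟶ K)) :
    IsLUB (Set.range fun n => f ≫ c n) (f ≫ ωSup c) := by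
  have h := (OmegaCpoCategory.comp_continuous A B K).isLUB
    (c := (Chain.mk (OrderHom.const ℕ f)).zip c)
  have e : ωSup (Chain.mk (OrderHom.const ℕ f)) = f :=
    le_antisymm (ωSup_le _ _ fun _ => le_rfl) (le_ωSup (Chain.mk (OrderHom.const ℕ f)) 0)
  rw [Prod.ωSup_zip, e] at h
  exact h

end Enriched

section EnrichedIteration

variable {C : Type u} [Category.{v} C] [ChosenFiniteCoproducts C]

/-- The morphism `[inl, f] : B ⊔ A ⟶ B ⊔ A`. -/
def loopStep {A B : C} (f : A ⟶ sum B A) : sum B A ⟶ sum B A := desc (inl B A) f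

/-- The `n`-th power of the endomorphism `[inl, f]` of `B ⊔ A`. -/
def loopPow {A B : C} (f : A ⟶ sum B A) : ℕ → (sum B A ⟶ sum B A)
  | 0 => 𝟙 _
  | n + 1 => loopPow f n ≫ loopStep f

theorem loopPow_succ' {A B : C} (f : A ⟶ sum B A) (n : ℕ) :
    loopPow f (n + 1) = loopStep f ≫ loopPow f n := by
  induction n with
  | zero => simp [loopPow]
  | succ n ih =>
    calc loopPow f (n + 1 + 1) = (loopStep f ≫ loopPow f n) ≫ loopStep f := by rw [← ih]; rfl
      _ = loopStep f ≫ loopPow f (n + 1) := by rw [Category.assoc]; rfl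

theorem desc_comp {A B K K' : C} (f : A ⟶ K) (g : B ⟶ K) (h : K ⟶ K') :
    desc f g ≫ h = desc (f ≫ h) (g ≫ h) :=
  sum_hom_ext (by simp) (by simp)

variable [OmegaCpoCategory C] [OmegaCpoCoproducts C]

/-- The ω-chain `[id, ⊥] ∘ g ≤ [id, ⊥] ∘ g² ≤ ⋯` in `C(B ⊔ A, B)`, where `g = [inl, f]`. -/
def iterChain {A B : C} (f : A ⟶ sum B A) : Chain (sum B A ⟶ B) where
  toFun n := loopPow f (n + 1) ≫ desc (𝟙 B) ⊥
  monotone' := monotone_nat_of_le_succ fun n => by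
    have h : desc (𝟙 B) ⊥ ≤ loopStep f ≫ desc (𝟙 B) (⊥ : A ⟶ B) := by
      rw [loopStep, desc_comp, inl_desc]
      exact OmegaCpoCoproducts.desc_mono le_rfl bot_le
    change _ ≤ (loopPow f (n + 1) ≫ loopStep f) ≫ desc (𝟙 B) ⊥
    rw [Category.assoc]
    exact comp_le_comp le_rfl h

/-- The enriched iteration: `iter f = (⨆ₙ [id, ⊥] ∘ [inl, f]ⁿ) ∘ inr`. -/
def omegaIter : Iteration C := fun A B f => inr B A ≫ ωSup (iterChain f)

theorem inl_ωSup_iterChain {A B : C} (f : A ⟶ sum B A) :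
    inl B A ≫ ωSup (iterChain f) = 𝟙 B := by
  have h : ∀ n, inl B A ≫ iterChain f n = 𝟙 B := by
    intro n
    change inl B A ≫ loopPow f (n + 1) ≫ desc (𝟙 B) ⊥ = 𝟙 B
    induction n with
    | zero => simp [loopPow, loopStep]
    | succ n ih => rw [loopPow_succ', loopStep, Category.assoc, inl_desc_assoc, ih]
  refine (isLUB_comp_ωSup (inl B A) (iterChain f)).unique ?_
  simp only [h, Set.range_const]
  exact isLUB_singleton

theorem ωSup_iterChain_eq {A B : C} (f : A ⟶ sum B A) :
    ωSup (iterChain f) = desc (𝟙 B) (omegaIter A B f) :=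
  sum_hom_ext (by rw [inl_ωSup_iterChain, inl_desc]) (by rw [inr_desc]; rfl)

/-- The basic fixed point equation for the enriched iteration. -/
theorem omegaIter_fix {A B : C} (f : A ⟶ sum B A) :
    f ≫ desc (𝟙 B) (omegaIter A B f) = omegaIter A B f := by
  have h : loopStep f ≫ ωSup (iterChain f) = ωSup (iterChain f) := by
    have hs : ∀ n, loopStep f ≫ iterChain f n = iterChain f (n + 1) := by
      intro n
      change loopStep f ≫ loopPow f (n + 1) ≫ _ = loopPow f (n + 1 + 1) ≫ _
      rw [loopPow_succ' f (n + 1), Category.assoc]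
    refine (isLUB_comp_ωSup (loopStep f) (iterChain f)).unique ?_
    simp only [hs]
    constructor
    · rintro _ ⟨n, rfl⟩
      exact le_ωSup _ _
    · intro x hx
      exact ωSup_le _ _ fun n => ((iterChain f).monotone n.le_succ).trans (hx ⟨n, rfl⟩)
  have h' := congrArg (inr B A ≫ ·) h
  rw [← ωSup_iterChain_eq]
  simpa [loopStep, omegaIter] using h'

/-- The enriched iteration is the least prefixed point. -/
theorem omegaIter_le {A B : C} (f : A ⟶ sum B A) (h : A ⟶ B)
    (hh : f ≫ desc (𝟙 B) h ≤ h) : omegaIter A B f ≤ h := by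
  have key : ∀ n, loopPow f n ≫ desc (𝟙 B) ⊥ ≤ desc (𝟙 B) h := by
    intro n
    induction n with
    | zero =>
      rw [loopPow, Category.id_comp]
      exact OmegaCpoCoproducts.desc_mono le_rfl bot_le
    | succ n ih =>
      rw [loopPow_succ', Category.assoc]
      refine (comp_le_comp le_rfl ih).trans ?_
      rw [loopStep, desc_comp, inl_desc]
      exact OmegaCpoCoproducts.desc_mono le_rfl hh
  have := comp_le_comp (le_refl (inr B A)) (ωSup_le (iterChain f) _ fun n => key (n + 1))
  rwa [inr_desc] at this

end EnrichedIteration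

/-! ### Strictly indexed categories and their op-Grothendieck constructions -/

section Indexed

variable {C : Type u} [Category.{v} C] (L : Cᵒᵖ ⥤ Cat.{v₂, u₂})

/-- The substitution functor `L(f) : L(B) ⥤ L(A)` along `f : A ⟶ B`. -/
def sub {A B : C} (f : A ⟶ B) : L.obj (op B) ⥤ L.obj (op A) := (L.map f.op).toFunctor

theorem sub_id (A : C) : sub L (𝟙 A) = 𝟭 _ := by
  rw [sub, op_id, L.map_id]; rfl

theorem sub_comp {A B K : C} (f : A ⟶ B) (g : B ⟶ K) :
    sub L (f ≫ g) = sub L g ⋙ sub L f := by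
  rw [sub, op_comp, L.map_comp]; rfl

theorem sub_id_obj {A : C} (X : L.obj (op A)) : (sub L (𝟙 A)).obj X = X := by
  rw [sub_id]; rfl

theorem sub_comp_obj {A B K : C} (f : A ⟶ B) (g : B ⟶ K) (Z : L.obj (op K)) :
    (sub L (f ≫ g)).obj Z = (sub L f).obj ((sub L g).obj Z) := by
  rw [sub_comp]; rfl

theorem sub_id_map {A : C} {X Y : L.obj (op A)} (x : X ⟶ Y) :
    (sub L (𝟙 A)).map x = eqToHom (sub_id_obj L X) ≫ x ≫ eqToHom (sub_id_obj L Y).symm := by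
  simpa using Functor.congr_hom (sub_id L A) x

theorem sub_comp_map {A B K : C} (f : A ⟶ B) (g : B ⟶ K) {X Y : L.obj (op K)} (x : X ⟶ Y) :
    (sub L (f ≫ g)).map x = eqToHom (sub_comp_obj L f g X) ≫ (sub L f).map ((sub L g).map x) ≫
      eqToHom (sub_comp_obj L f g Y).symm := by
  simpa using Functor.congr_hom (sub_comp L f g) x

/-- Objects `(A, X)` of the op-Grothendieck construction `Σ_C L^op`. -/
structure Container where
  base : C
  fib : L.obj (op base)

namespace Container

variable {L}

/-- Morphisms `(f, f') : (A, X) ⟶ (B, Y)` of `Σ_C L^op`: a morphism `f : A ⟶ B` of `C` together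
with a morphism `f' : L(f)(Y) ⟶ X` of `L(A)`. -/
structure Hom (P Q : Container L) where
  base : P.base ⟶ Q.base
  fib : (sub L base).obj Q.fib ⟶ P.fib

theorem Hom.ext_eqToHom {P Q : Container L} {F G : Hom P Q} (hb : F.base = G.base)
    (hf : F.fib = eqToHom (by rw [hb]) ≫ G.fib) : F = G := by
  cases F; cases G
  cases hb
  simpa using hf

/-- The op-Grothendieck construction `Σ_C L^op` is a category. -/
instance : Category (Container L) where
  Hom := Hom
  id P := ⟨𝟙 P.base, eqToHom (sub_id_obj L P.fib)⟩
  comp {P Q R} F G := ⟨F.base ≫ G.base,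
    eqToHom (sub_comp_obj L F.base G.base R.fib) ≫ (sub L F.base).map G.fib ≫ F.fib⟩
  id_comp F := Hom.ext_eqToHom (Category.id_comp _) (by simp [sub_id_map])
  comp_id F := Hom.ext_eqToHom (Category.comp_id _) (by simp [eqToHom_map])
  assoc F G H := Hom.ext_eqToHom (Category.assoc _ _ _) (by simp [eqToHom_map, sub_comp_map])

@[simp] theorem id_base (P : Container L) : Hom.base (𝟙 P) = 𝟙 P.base := rfl

@[simp] theorem id_fib (P : Container L) : Hom.fib (𝟙 P) = eqToHom (sub_id_obj L P.fib) := rfl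

@[simp] theorem comp_base {P Q R : Container L} (F : P ⟶ Q) (G : Q ⟶ R) :
    Hom.base (F ≫ G) = Hom.base F ≫ Hom.base G := rfl

@[simp] theorem comp_fib {P Q R : Container L} (F : P ⟶ Q) (G : Q ⟶ R) :
    Hom.fib (F ≫ G) = eqToHom (sub_comp_obj L (Hom.base F) (Hom.base G) R.fib) ≫
      (sub L (Hom.base F)).map (Hom.fib G) ≫ Hom.fib F := rfl

theorem Hom.fib_eq_of_eq {P Q : Container L} {F G : Hom P Q} (h : F = G) :
    F.fib = eqToHom (by rw [h]) ≫ G.fib := by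
  subst h; simp

theorem hom_ext {P Q : Container L} {F G : P ⟶ Q} (hb : Hom.base F = Hom.base G)
    (hf : Hom.fib F = eqToHom (by rw [hb]) ≫ Hom.fib G) : F = G :=
  Hom.ext_eqToHom hb hf

end Container

/-! ### Extensivity: coproducts in the op-Grothendieck construction -/

variable [ChosenFiniteCoproducts C]

/-- The comparison functor `L(B ⊔ A) ⥤ L(B) × L(A)`. -/
def comparison (B A : C) : L.obj (op (sum B A)) ⥤ L.obj (op B) × L.obj (op A) :=
  (sub L (inl B A)).prod' (sub L (inr B A))

variable [PreservesFiniteProducts L]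

theorem comparison_isIso (B A : C) : IsIso (comparison L B A).toCatHom := by
  have h₁ : IsLimit (BinaryFan.mk (inl B A).op (inr B A).op) :=
    BinaryCofan.IsColimit.op (isColimit B A)
  have h₂ : IsLimit (BinaryFan.mk (L.map (inl B A).op) (L.map (inr B A).op)) :=
    mapIsLimitOfPreservesOfIsLimit L _ _ h₁
  have e : (comparison L B A).toCatHom = (h₂.conePointUniqueUpToIso
      (Cat.isLimitProdCone (L.obj (op B)) (L.obj (op A)))).hom := by
    refine BinaryFan.IsLimit.hom_ext (Cat.isLimitProdCone (L.obj (op B)) (L.obj (op A))) ?_ ?_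
    · exact (h₂.conePointUniqueUpToIso_hom_comp
        (Cat.isLimitProdCone (L.obj (op B)) (L.obj (op A))) ⟨WalkingPair.left⟩).symm
    · exact (h₂.conePointUniqueUpToIso_hom_comp
        (Cat.isLimitProdCone (L.obj (op B)) (L.obj (op A))) ⟨WalkingPair.right⟩).symm
  rw [e]
  exact (h₂.conePointUniqueUpToIso
    (Cat.isLimitProdCone (L.obj (op B)) (L.obj (op A)))).isIso_hom

/-- The inverse `S : L(B) × L(A) ⥤ L(B ⊔ A)` of the comparison functor. -/
noncomputable def glue (B A : C) : L.obj (op B) × L.obj (op A) ⥤ L.obj (op (sum B A)) :=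
  haveI := comparison_isIso L B A
  (inv (comparison L B A).toCatHom).toFunctor

theorem glue_comparison (B A : C) : glue L B A ⋙ comparison L B A = 𝟭 _ := by
  have := comparison_isIso L B A
  exact congrArg Cat.Hom.toFunctor (IsIso.inv_hom_id (comparison L B A).toCatHom)

theorem comparison_glue (B A : C) : comparison L B A ⋙ glue L B A = 𝟭 _ := by
  have := comparison_isIso L B A
  exact congrArg Cat.Hom.toFunctor (IsIso.hom_inv_id (comparison L B A).toCatHom)

theorem prod_fst_conj {D : Type u₁} {E : Type u₃} [Category.{v₁} D] [Category.{v₃} E]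
    {p q r s : D × E} (h : p = q) (m : q ⟶ r) (h' : r = s) :
    (eqToHom h ≫ m ≫ eqToHom h').1 =
      eqToHom (congrArg Prod.fst h) ≫ m.1 ≫ eqToHom (congrArg Prod.fst h') := by
  subst h h'; simp

theorem prod_snd_conj {D : Type u₁} {E : Type u₃} [Category.{v₁} D] [Category.{v₃} E]
    {p q r s : D × E} (h : p = q) (m : q ⟶ r) (h' : r = s) :
    (eqToHom h ≫ m ≫ eqToHom h').2 =
      eqToHom (congrArg Prod.snd h) ≫ m.2 ≫ eqToHom (congrArg Prod.snd h') := by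
  subst h h'; simp

theorem eqToHom_conj_cancel {D : Type u₁} [Category.{v₁} D] {p q r s : D} (h : p = q)
    {m m' : q ⟶ r} (h' : r = s)
    (e : eqToHom h ≫ m ≫ eqToHom h' = eqToHom h ≫ m' ≫ eqToHom h') : m = m' := by
  subst h h'; simpa using e

theorem eqToHom_conj_of_eq {D : Type u₁} [Category.{v₁} D] {p q r s x : D} (h : p = q)
    (h' : r = s) (h₁ : q = x) (h₂ : s = r) {m : q ⟶ r} {φ : x ⟶ s}
    (e : m = eqToHom h₁ ≫ φ ≫ eqToHom h₂) :
    eqToHom h ≫ m ≫ eqToHom h' = eqToHom (h.trans h₁) ≫ φ := by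
  subst h h' h₁; simpa using e

theorem inl_glue {B A : C} (Y : L.obj (op B)) (X : L.obj (op A)) :
    (sub L (inl B A)).obj ((glue L B A).obj (Y, X)) = Y :=
  congrArg Prod.fst (Functor.congr_obj (glue_comparison L B A) (Y, X))

theorem inr_glue {B A : C} (Y : L.obj (op B)) (X : L.obj (op A)) :
    (sub L (inr B A)).obj ((glue L B A).obj (Y, X)) = X :=
  congrArg Prod.snd (Functor.congr_obj (glue_comparison L B A) (Y, X))

theorem inl_glue_map {B A : C} {Y Y' : L.obj (op B)} {X X' : L.obj (op A)} (y : Y ⟶ Y')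
    (x : X ⟶ X') : (sub L (inl B A)).map ((glue L B A).map (Prod.mkHom y x)) =
      eqToHom (inl_glue L Y X) ≫ y ≫ eqToHom (inl_glue L Y' X').symm := by
  exact (congrArg Prod.fst (Functor.congr_hom (glue_comparison L B A)
    (Prod.mkHom y x))).trans
    (prod_fst_conj _ _ _)

theorem inr_glue_map {B A : C} {Y Y' : L.obj (op B)} {X X' : L.obj (op A)} (y : Y ⟶ Y')
    (x : X ⟶ X') : (sub L (inr B A)).map ((glue L B A).map (Prod.mkHom y x)) =
      eqToHom (inr_glue L Y X) ≫ x ≫ eqToHom (inr_glue L Y' X').symm := by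
  exact (congrArg Prod.snd (Functor.congr_hom (glue_comparison L B A)
    (Prod.mkHom y x))).trans
    (prod_snd_conj _ _ _)

/-- Objects of `L(B ⊔ A)` are determined by their two restrictions. -/
theorem fib_sum_ext {B A : C} {Z Z' : L.obj (op (sum B A))}
    (hl : (sub L (inl B A)).obj Z = (sub L (inl B A)).obj Z')
    (hr : (sub L (inr B A)).obj Z = (sub L (inr B A)).obj Z') : Z = Z' := by
  have h := Functor.congr_obj (comparison_glue L B A)
  rw [← show _ = Z from h Z, ← show _ = Z' from h Z']
  exact congrArg (glue L B A).obj (Prod.ext hl hr)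

/-- The comparison functor as an equivalence. -/
noncomputable def comparisonEquiv (B A : C) :
    L.obj (op (sum B A)) ≌ L.obj (op B) × L.obj (op A) :=
  CategoryTheory.Equivalence.mk (comparison L B A) (glue L B A)
    (eqToIso (comparison_glue L B A).symm) (eqToIso (glue_comparison L B A))

instance (B A : C) : (comparison L B A).IsEquivalence :=
  (comparisonEquiv L B A).isEquivalence_functor

/-- Morphisms of `L(B ⊔ A)` are determined by their two restrictions. -/
theorem fib_sum_hom_ext {B A : C} {Z Z' : L.obj (op (sum B A))} {h h' : Z ⟶ Z'}
    (hl : (sub L (inl B A)).map h = (sub L (inl B A)).map h')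
    (hr : (sub L (inr B A)).map h = (sub L (inr B A)).map h') : h = h' :=
  (comparison L B A).map_injective (Prod.ext hl hr)

/-- The morphism of `L(B ⊔ A)` with given restrictions. -/
noncomputable def fibLift {B A : C} {Z Z' : L.obj (op (sum B A))}
    (l : (sub L (inl B A)).obj Z ⟶ (sub L (inl B A)).obj Z')
    (r : (sub L (inr B A)).obj Z ⟶ (sub L (inr B A)).obj Z') : Z ⟶ Z' :=
  (comparison L B A).preimage (X := Z) (Y := Z') (l, r)

theorem inl_fibLift {B A : C} {Z Z' : L.obj (op (sum B A))}
    (l : (sub L (inl B A)).obj Z ⟶ (sub L (inl B A)).obj Z')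
    (r : (sub L (inr B A)).obj Z ⟶ (sub L (inr B A)).obj Z') :
    (sub L (inl B A)).map (fibLift L l r) = l :=
  congrArg Prod.fst ((comparison L B A).map_preimage (X := Z) (Y := Z') (l, r))

theorem inr_fibLift {B A : C} {Z Z' : L.obj (op (sum B A))}
    (l : (sub L (inl B A)).obj Z ⟶ (sub L (inl B A)).obj Z')
    (r : (sub L (inr B A)).obj Z ⟶ (sub L (inr B A)).obj Z') :
    (sub L (inr B A)).map (fibLift L l r) = r :=
  congrArg Prod.snd ((comparison L B A).map_preimage (X := Z) (Y := Z') (l, r))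

theorem fib_zero_isTerminal : Nonempty (IsTerminal (L.obj (op (zero : C)))) := by
  have h : IsTerminal (op (zero : C)) := terminalOpOfInitial zeroIsInitial
  exact ⟨IsTerminal.isTerminalObj L _ h⟩

theorem fib_zero_nonempty : Nonempty (L.obj (op (zero : C))) := by
  obtain ⟨h⟩ := fib_zero_isTerminal (C := C) L
  let _ : Category.{v₂} PUnit.{u₂ + 1} :=
    { Hom := fun _ _ => PUnit
      id := fun _ => PUnit.unit
      comp := fun _ _ => PUnit.unit }
  exact ⟨(h.from (Cat.of PUnit.{u₂ + 1})).toFunctor.obj PUnit.unit⟩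

/-- `L(0)` is the terminal category. -/
theorem fib_zero_unique (x y : L.obj (op (zero : C))) : Nonempty (Unique (x ⟶ y)) := by
  obtain ⟨h⟩ := fib_zero_isTerminal (C := C) L
  have e : (Functor.const (L.obj (op (zero : C)))).obj x = 𝟭 _ :=
    congrArg Cat.Hom.toFunctor (h.hom_ext
      (Functor.toCatHom ((Functor.const (L.obj (op (zero : C)))).obj x)) (𝟙 _))
  have hy : x = y := Functor.congr_obj e y
  subst hy
  refine ⟨⟨⟨𝟙 _⟩, fun f => ?_⟩⟩
  have := Functor.congr_hom e f
  simpa using this.symm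

namespace Container

variable {L}

/-- The coproduct `(B, Y) ⊔ (A, X) = (B ⊔ A, S(Y, X))`. -/
noncomputable abbrev sum (P Q : Container L) : Container L :=
  ⟨ChosenFiniteCoproducts.sum P.base Q.base, (glue L P.base Q.base).obj (P.fib, Q.fib)⟩

/-- The first coprojection. -/
noncomputable def inl (P Q : Container L) : P ⟶ sum P Q :=
  Hom.mk (ChosenFiniteCoproducts.inl P.base Q.base) (eqToHom (inl_glue L P.fib Q.fib))

/-- The second coprojection. -/
noncomputable def inr (P Q : Container L) : Q ⟶ sum P Q :=
  Hom.mk (ChosenFiniteCoproducts.inr P.base Q.base) (eqToHom (inr_glue L P.fib Q.fib))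

/-- The copairing in `Σ_C L^op`. -/
noncomputable def copair {P Q R : Container L} (F : P ⟶ R) (G : Q ⟶ R) : sum P Q ⟶ R :=
  Hom.mk (IterCat.desc (Hom.base F) (Hom.base G)) (fibLift L
    (eqToHom (by rw [← sub_comp_obj, inl_desc]) ≫ Hom.fib F ≫
      eqToHom (inl_glue L P.fib Q.fib).symm)
    (eqToHom (by rw [← sub_comp_obj, inr_desc]) ≫ Hom.fib G ≫
      eqToHom (inr_glue L P.fib Q.fib).symm))

theorem inl_copair {P Q R : Container L} (F : P ⟶ R) (G : Q ⟶ R) :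
    inl P Q ≫ copair F G = F :=
  hom_ext (inl_desc _ _) (eqToHom_conj_of_eq _ (inl_glue L P.fib Q.fib) _ _ (m := (sub L _).map _)
    (inl_fibLift L _ _))

theorem inr_copair {P Q R : Container L} (F : P ⟶ R) (G : Q ⟶ R) :
    inr P Q ≫ copair F G = G :=
  hom_ext (inr_desc _ _) (eqToHom_conj_of_eq _ (inr_glue L P.fib Q.fib) _ _ (m := (sub L _).map _)
    (inr_fibLift L _ _))

theorem copair_hom_ext {P Q R : Container L} {H H' : sum P Q ⟶ R}
    (hl : inl P Q ≫ H = inl P Q ≫ H') (hr : inr P Q ≫ H = inr P Q ≫ H') : H = H' := by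
  obtain ⟨b, φ⟩ := H
  obtain ⟨b', φ'⟩ := H'
  have hb : b = b' := IterCat.sum_hom_ext (congrArg Hom.base hl) (congrArg Hom.base hr)
  subst hb
  have h₁ := eq_of_heq (Hom.mk.inj hl).2
  have h₂ := eq_of_heq (Hom.mk.inj hr).2
  have h : φ = φ' := fib_sum_hom_ext L
    (eqToHom_conj_cancel _ (inl_glue L P.fib Q.fib) h₁)
    (eqToHom_conj_cancel _ (inr_glue L P.fib Q.fib) h₂)
  rw [h]

/-- The chosen finite coproducts of `Σ_C L^op`: the initial object is `(0, 1)`, where `1` is the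
only object of `L(0)`, and `(B, Y) ⊔ (A, X) = (B ⊔ A, S(Y, X))`. -/
noncomputable instance : ChosenFiniteCoproducts (Container L) where
  zero := ⟨zero, (fib_zero_nonempty L).some⟩
  zeroIsInitial := IsInitial.ofUniqueHom
    (fun P => Hom.mk (zeroIsInitial.to P.base) (fib_zero_unique L _ _).some.default)
    (fun _ _ => hom_ext (zeroIsInitial.hom_ext _ _)
      ((@Unique.instSubsingleton _ (fib_zero_unique L _ _).some).elim _ _))
  sum := sum
  inl := inl
  inr := inr
  isColimit _ _ := BinaryCofan.IsColimit.mk _ (fun F G => copair F G)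
    (fun F G => inl_copair F G) (fun F G => inr_copair F G)
    (fun F G _ h₁ h₂ => copair_hom_ext (h₁.trans (inl_copair F G).symm)
      (h₂.trans (inr_copair F G).symm))

end Container

end Indexed

/-! ### Parameterized initial algebras -/

section Algebras

variable {D' : Type u₁} [Category.{v₁} D'] {D : Type u₃} [Category.{v₃} D]

/-- The endofunctor `H^X = H(X, -)`. -/
abbrev section₂ (H : D' × D ⥤ D) (X : D') : D ⥤ D := Prod.sectR X D ⋙ H

/-- The parameterized initial algebra of `H` exists: every `H(X, -)` has an initial algebra. -/
class HasParamInitialAlgebra (H : D' × D ⥤ D) : Prop where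
  hasInitial (X : D') : HasInitial (Endofunctor.Algebra (section₂ H X))

attribute [instance] HasParamInitialAlgebra.hasInitial

theorem mu_id_aux (H : D' × D ⥤ D) {X : D'} {M : D} (s : H.obj (X, M) ⟶ M) :
    H.map (Prod.mkHom (𝟙 X) (𝟙 M)) ≫ H.map (Prod.mkHom (𝟙 X) (𝟙 M)) ≫ s = s ≫ 𝟙 M := by
  have e : H.map (Prod.mkHom (𝟙 X) (𝟙 M)) = 𝟙 _ := H.map_id (X, M)
  rw [e, Category.id_comp, Category.id_comp, Category.comp_id]

theorem mu_comp_aux (H : D' × D ⥤ D) {X Y Z : D'} (x : X ⟶ Y) (y : Y ⟶ Z) {M N K : D}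
    (s : H.obj (X, M) ⟶ M) (t : H.obj (Y, N) ⟶ N) (r : H.obj (Z, K) ⟶ K)
    (φ : M ⟶ N) (ψ : N ⟶ K)
    (hφ : H.map (Prod.mkHom (𝟙 X) φ) ≫ H.map (Prod.mkHom x (𝟙 N)) ≫ t = s ≫ φ)
    (hψ : H.map (Prod.mkHom (𝟙 Y) ψ) ≫ H.map (Prod.mkHom y (𝟙 K)) ≫ r = t ≫ ψ) :
    H.map (Prod.mkHom (𝟙 X) (φ ≫ ψ)) ≫ H.map (Prod.mkHom (x ≫ y) (𝟙 K)) ≫ r = s ≫ φ ≫ ψ := by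
  rw [← Category.assoc s, ← hφ, Category.assoc, Category.assoc, ← hψ]
  simp only [← Category.assoc, ← H.map_comp]
  congr 2
  ext <;> simp

theorem mu_nat_aux (H : D' × D ⥤ D) {X Y : D'} (x : X ⟶ Y) {M N K : D}
    (s : H.obj (X, M) ⟶ M) (t : H.obj (Y, N) ⟶ N) (r : H.obj (Y, K) ⟶ K)
    (φ : M ⟶ N) (ψ : N ⟶ K) (hφ : H.map (Prod.mkHom x φ) ≫ t = s ≫ φ)
    (hψ : H.map (Prod.mkHom (𝟙 Y) ψ) ≫ r = t ≫ ψ) :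
    H.map (Prod.mkHom (𝟙 X) (φ ≫ ψ)) ≫ H.map (Prod.mkHom x (𝟙 K)) ≫ r = s ≫ φ ≫ ψ := by
  rw [← Category.assoc s, ← hφ, Category.assoc, ← hψ]
  simp only [← Category.assoc, ← H.map_comp]
  congr 2
  ext <;> simp

variable (H : D' × D ⥤ D) [HasParamInitialAlgebra H]

/-- The initial algebra `(μ H^X, in : H^X (μ H^X) ⟶ μ H^X)`. -/
noncomputable abbrev initialAlgebra (X : D') : Endofunctor.Algebra (section₂ H X) := ⊥_ _

/-- The fold `μ H^X ⟶ W` of an `H^X`-algebra `(W, ζ)`. -/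
noncomputable def fold (X : D') (W : Endofunctor.Algebra (section₂ H X)) :
    (initialAlgebra H X).a ⟶ W.a :=
  Endofunctor.Algebra.Hom.f (initial.to W)

theorem fold_str (X : D') (W : Endofunctor.Algebra (section₂ H X)) :
    (section₂ H X).map (fold H X W) ≫ W.str = (initialAlgebra H X).str ≫ fold H X W :=
  Endofunctor.Algebra.Hom.h (initial.to W)

theorem fold_unique (X : D') (W : Endofunctor.Algebra (section₂ H X))
    (k : (initialAlgebra H X).a ⟶ W.a)
    (hk : (section₂ H X).map k ≫ W.str = (initialAlgebra H X).str ≫ k) : k = fold H X W :=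
  congrArg Endofunctor.Algebra.Hom.f
    (initial.hom_ext (Endofunctor.Algebra.Hom.mk k hk : initialAlgebra H X ⟶ W) (initial.to W))

/-- For `x : X ⟶ Y`, the `H^X`-algebra `in ∘ H(x, μ H^Y)` on `μ H^Y`. -/
noncomputable def pullAlgebra {X Y : D'} (x : X ⟶ Y) : Endofunctor.Algebra (section₂ H X) where
  a := (initialAlgebra H Y).a
  str := H.map (Prod.mkHom x (𝟙 _)) ≫ (initialAlgebra H Y).str

/-- The parameterized initial algebra `μ H : D' ⥤ D`, given on objects by `X ↦ μ H^X` and on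
morphisms by `x ↦ fold (in ∘ H(x, μ H^Y))`. -/
noncomputable def mu : D' ⥤ D where
  obj X := (initialAlgebra H X).a
  map {X Y} x := fold H X (pullAlgebra H x)
  map_id X := by
    refine (fold_unique H X _ _ ?_).symm
    exact mu_id_aux H (initialAlgebra H X).str
  map_comp {X Y Z} x y := by
    refine (fold_unique H X _ _ ?_).symm
    exact mu_comp_aux H x y _ _ _ _ _ (fold_str H X (pullAlgebra H x))
      (fold_str H Y (pullAlgebra H y))

end Algebras

/-! ### Iteration-extensive indexed categories and container iteration -/

section IterationExtensive

variable {C : Type u} [Category.{v} C] [ChosenFiniteCoproducts C]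

/-- An iteration-extensive indexed category `(C, iter, L)`: an extensive indexed category `L`
(that is, a functor `Cᵒᵖ ⥤ Cat` that preserves finite products) over an iterative category
`(C, iter)` such that, for `f : A ⟶ B ⊔ A`, the parameterized initial algebra of
`L(f) ∘ S : L(B) × L(A) ⥤ L(A)` exists and is isomorphic to `L(iter f)`. -/
structure IterationExtensive (iter : Iteration C) (L : Cᵒᵖ ⥤ Cat.{v₂, u₂})
    [PreservesFiniteProducts L] where
  exists_mu {A B : C} (f : A ⟶ sum B A) : HasParamInitialAlgebra (glue L B A ⋙ sub L f)
  iso {A B : C} (f : A ⟶ sum B A) : sub L (iter A B f) ≅ mu (glue L B A ⋙ sub L f)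

/-- The container iteration `(f, f') ↦ (iter f, fold (X, f'))` on `Σ_C L^op`, for
`(f, f') : (A, X) ⟶ (B, Y) ⊔ (A, X)`; here `f' : L(f)(S(Y, X)) ⟶ X` is an algebra structure on
`X`, and `L(iter f)(Y)` is identified with the carrier of the initial algebra. -/
noncomputable def containerIter {iter : Iteration C} {L : Cᵒᵖ ⥤ Cat.{v₂, u₂}}
    [PreservesFiniteProducts L] (E : IterationExtensive iter L) : Iteration (Container L) :=
  fun P Q F =>
    haveI := E.exists_mu (Container.Hom.base F)
    Container.Hom.mk (iter P.base Q.base (Container.Hom.base F))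
      ((E.iso (Container.Hom.base F)).hom.app Q.fib ≫
        fold (glue L Q.base P.base ⋙ sub L (Container.Hom.base F)) Q.fib
          ⟨P.fib, Container.Hom.fib F⟩)

end IterationExtensive

/-! ### Enriched indexed categories and the enrichment of the op-Grothendieck construction -/

section EnrichedIndexed

/-- An extension of a (strictly) indexed category `L` over an ω-Cpo-enriched category `C` to a
2-functor: natural transformations `L(f ≤ g) : L(f) ⟶ L(g)`, compatible with identities, vertical
composition and horizontal composition. -/
class TwoFunctor {C : Type u} [Category.{v} C] [OmegaCpoCategory C]
    (L : Cᵒᵖ ⥤ Cat.{v₂, u₂}) where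
  map₂ {A B : C} {f g : A ⟶ B} (h : f ≤ g) : sub L f ⟶ sub L g
  map₂_refl {A B : C} (f : A ⟶ B) : map₂ (le_refl f) = 𝟙 (sub L f)
  map₂_trans {A B : C} {f g h : A ⟶ B} (h₁ : f ≤ g) (h₂ : g ≤ h) :
    map₂ h₁ ≫ map₂ h₂ = map₂ (h₁.trans h₂)
  map₂_hcomp {A B K : C} {f f' : A ⟶ B} {g g' : B ⟶ K} (hf : f ≤ f') (hg : g ≤ g') :
    map₂ (comp_le_comp hf hg) = eqToHom (sub_comp L f g) ≫
      NatTrans.hcomp (map₂ hg) (map₂ hf) ≫ eqToHom (sub_comp L f' g').symm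

open TwoFunctor

/-- The functor `C(A, B) ⥤ (L(B) ⥤ L(A))`. -/
def localFunctor {C : Type u} [Category.{v} C] [OmegaCpoCategory C] (L : Cᵒᵖ ⥤ Cat.{v₂, u₂})
    [TwoFunctor L] (A B : C) : (A ⟶ B) ⥤ (L.obj (op B) ⥤ L.obj (op A)) where
  obj f := sub L f
  map h := map₂ (leOfHom h)
  map_id f := map₂_refl f
  map_comp h₁ h₂ := (map₂_trans (leOfHom h₁) (leOfHom h₂)).symm

/-- An ω-Cpo-enriched indexed category `(C, L)`: a 2-functor `L` such that every `L(A)` has an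
initial object and colimits of ω-chains, and such that the functors `C(A, B) ⥤ (L(B) ⥤ L(A))`
preserve initial objects and colimits of ω-chains. -/
class OmegaCpoIndexed {C : Type u} [Category.{v} C] [OmegaCpoCategory C]
    (L : Cᵒᵖ ⥤ Cat.{v₂, u₂}) extends TwoFunctor L where
  hasInitial (A : C) : HasInitial (L.obj (op A))
  hasColimits (A : C) : HasColimitsOfShape ℕ (L.obj (op A))
  preservesInitial (A B : C) :
    PreservesColimitsOfShape (Discrete PEmpty.{1}) (localFunctor L A B)
  preservesChains (A B : C) : PreservesColimitsOfShape ℕ (localFunctor L A B)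

open OmegaCpoIndexed

variable {C : Type u} [Category.{v} C] [OmegaCpoCategory C] (L : Cᵒᵖ ⥤ Cat.{v₂, u₂})
  [OmegaCpoIndexed L]

/-- The component at `Y` of the natural transformation `L(f ≤ g)`. -/
def cell {A B : C} {f g : A ⟶ B} (h : f ≤ g) (Y : L.obj (op B)) :
    (sub L f).obj Y ⟶ (sub L g).obj Y := (map₂ (L := L) h).app Y

theorem cell_refl {A B : C} (f : A ⟶ B) (Y : L.obj (op B)) :
    cell L (le_refl f) Y = 𝟙 _ := by
  rw [cell, map₂_refl]; rfl

theorem cell_eq {A B : C} {f g : A ⟶ B} (e : f = g) (Y : L.obj (op B)) :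
    cell L (le_of_eq e) Y = eqToHom (by rw [e]) := by
  subst e; exact cell_refl L f Y

theorem cell_trans {A B : C} {f g h : A ⟶ B} (h₁ : f ≤ g) (h₂ : g ≤ h) (Y : L.obj (op B)) :
    cell L h₁ Y ≫ cell L h₂ Y = cell L (h₁.trans h₂) Y := by
  rw [cell, cell, cell, ← map₂_trans h₁ h₂]; rfl

theorem cell_naturality {A B : C} {f g : A ⟶ B} (h : f ≤ g) {Y Y' : L.obj (op B)} (y : Y ⟶ Y') :
    (sub L f).map y ≫ cell L h Y' = cell L h Y ≫ (sub L g).map y :=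
  (map₂ (L := L) h).naturality y

theorem cell_naturality_assoc {A B : C} {f g : A ⟶ B} (h : f ≤ g) {Y Y' : L.obj (op B)}
    (y : Y ⟶ Y') {W : L.obj (op A)} (k : (sub L g).obj Y' ⟶ W) :
    (sub L f).map y ≫ cell L h Y' ≫ k = cell L h Y ≫ (sub L g).map y ≫ k := by
  rw [← Category.assoc, cell_naturality, Category.assoc]

theorem cell_comp {A B K : C} {f f' : A ⟶ B} {g g' : B ⟶ K} (hf : f ≤ f') (hg : g ≤ g')
    (Z : L.obj (op K)) :
    cell L (comp_le_comp hf hg) Z = eqToHom (sub_comp_obj L f g Z) ≫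
      (cell L hf ((sub L g).obj Z) ≫ (sub L f').map (cell L hg Z)) ≫
      eqToHom (sub_comp_obj L f' g' Z).symm := by
  have h := NatTrans.congr_app (map₂_hcomp (L := L) hf hg) Z
  simpa [eqToHom_app, cell] using h

theorem map_cell_comp {A A' K : C} (i : A' ⟶ A) {b b' : A ⟶ K} (hb : b ≤ b')
    (Z : L.obj (op K)) {W : L.obj (op A)} {X : L.obj (op A')} (φ : (sub L b).obj Z ⟶ W)
    (φ' : (sub L b').obj Z ⟶ W) (q : (sub L i).obj W = X)
    (h : cell L (comp_le_comp (le_refl i) hb) Z ≫ eqToHom (sub_comp_obj L i b' Z) ≫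
      (sub L i).map φ' ≫ eqToHom q = eqToHom (sub_comp_obj L i b Z) ≫
      (sub L i).map φ ≫ eqToHom q) :
    (sub L i).map (cell L hb Z ≫ φ') = (sub L i).map φ := by
  subst q
  rw [cell_comp L (le_refl i) hb, cell_refl] at h
  simpa [cancel_epi] using h

/-- `L(⊥)(Y)` is initial. -/
theorem isInitial_bot {A B : C} (Y : L.obj (op B)) :
    Nonempty (IsInitial ((sub L (⊥ : A ⟶ B)).obj Y)) := by
  have := hasInitial (L := L) A
  have := preservesInitial (L := L) A B
  have h₀ : IsInitial (⊥ : A ⟶ B) := IsInitial.ofUniqueHom (fun _ => homOfLE bot_le)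
    (fun _ _ => Subsingleton.elim _ _)
  have h₁ : IsInitial ((localFunctor L A B).obj ⊥) := IsInitial.isInitialObj _ _ h₀
  exact ⟨IsInitial.isInitialObj ((evaluation _ _).obj Y) _ h₁⟩

/-- `L(⨆ fₙ)(Y)` is the colimit of `L(f₀)(Y) ⟶ L(f₁)(Y) ⟶ ⋯`. -/
theorem existsUnique_ωSup {A B : C} (c : Chain (A ⟶ B)) (Y : L.obj (op B)) (W : L.obj (op A))
    (φ : ∀ n, (sub L (c n)).obj Y ⟶ W)
    (hφ : ∀ n m (h : n ≤ m), cell L (c.monotone h) Y ≫ φ m = φ n) :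
    ∃! k : (sub L (ωSup c)).obj Y ⟶ W, ∀ n, cell L (le_ωSup c n) Y ≫ k = φ n := by
  have := hasColimits (L := L) A
  have := preservesChains (L := L) A B
  let D : ℕ ⥤ (A ⟶ B) := c.monotone.functor
  let κ : Cocone D := { pt := ωSup c, ι := { app := fun n => homOfLE (le_ωSup c n) } }
  have hκ : IsColimit κ :=
    { desc := fun s => homOfLE (ωSup_le c _ fun n => leOfHom (s.ι.app n)) }
  have hE := isColimitOfPreserves
    (localFunctor L A B ⋙ (evaluation (L.obj (op B)) (L.obj (op A))).obj Y) hκ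
  let σ : Cocone (D ⋙ localFunctor L A B ⋙ (evaluation (L.obj (op B)) (L.obj (op A))).obj Y) :=
    { pt := W
      ι := { app := φ, naturality := fun n m h => (hφ n m (leOfHom h)).trans
              (Category.comp_id _).symm } }
  exact ⟨hE.desc σ, hE.fac σ, fun k hk => hE.uniq σ k hk⟩

/-! The order on the morphisms of `Σ_C L^op`. -/

namespace Container

variable {L}

/-- `(f, f') ≤ (g, g')` if and only if `f ≤ g` and `f' = g' ∘ L(f ≤ g)_Y`. -/
instance homLE (P Q : Container L) : LE (P ⟶ Q) :=
  ⟨fun F G => ∃ h : Hom.base F ≤ Hom.base G, cell L h Q.fib ≫ Hom.fib G = Hom.fib F⟩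

theorem le_def {P Q : Container L} {F G : P ⟶ Q} :
    F ≤ G ↔ ∃ h : Hom.base F ≤ Hom.base G, cell L h Q.fib ≫ Hom.fib G = Hom.fib F := Iff.rfl

theorem eq_of_le {P Q : Container L} {F G : P ⟶ Q} (h : F ≤ G)
    (hb : Hom.base F = Hom.base G) : F = G := by
  obtain ⟨h, e⟩ := h
  exact hom_ext hb (by rw [← e, cell_eq L hb])

instance homPartialOrder (P Q : Container L) : PartialOrder (P ⟶ Q) where
  le_refl F := ⟨le_rfl, by rw [cell_refl, Category.id_comp]⟩
  le_trans F G H h₁ h₂ := by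
    obtain ⟨h₁, e₁⟩ := h₁
    obtain ⟨h₂, e₂⟩ := h₂
    exact ⟨h₁.trans h₂, by rw [← cell_trans L h₁ h₂, Category.assoc, e₂, e₁]⟩
  le_antisymm F G h₁ h₂ := eq_of_le h₁ (le_antisymm h₁.1 h₂.1)

/-- The first component of an ω-chain. -/
def chainBase {P Q : Container L} (c : Chain (P ⟶ Q)) : Chain (P.base ⟶ Q.base) :=
  c.map ⟨Hom.base, fun _ _ h => h.1⟩

theorem existsUnique_fib {P Q : Container L} (c : Chain (P ⟶ Q)) :
    ∃! k : (sub L (ωSup (chainBase c))).obj Q.fib ⟶ P.fib,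
      ∀ n, cell L (le_ωSup (chainBase c) n) Q.fib ≫ k = Hom.fib (c n) :=
  existsUnique_ωSup L (chainBase c) Q.fib P.fib (fun n => Hom.fib (c n))
    (fun _ _ h => (c.monotone h).2)

/-- The colimit of an ω-chain `(gₙ, gₙ')` of morphisms `(A, X) ⟶ (B, Y)`: its first component is
`g = ⨆ gₙ` and its second component is induced by the morphisms `gₙ'` and the universal property
of `L(g)(Y)`, the colimit of the chain `L(gₙ)(Y)`. -/
noncomputable def homSup {P Q : Container L} (c : Chain (P ⟶ Q)) : P ⟶ Q :=
  Hom.mk (ωSup (chainBase c)) (existsUnique_fib c).choose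

noncomputable instance homOrder (P Q : Container L) : OmegaCompletePartialOrder (P ⟶ Q) where
  ωSup c := homSup c
  le_ωSup c n := ⟨le_ωSup (chainBase c) n, (existsUnique_fib c).choose_spec.1 n⟩
  ωSup_le c G hG := by
    have hb : ωSup (chainBase c) ≤ Hom.base G := ωSup_le _ _ fun n => (hG n).1
    refine ⟨hb, (existsUnique_fib c).choose_spec.2 _ fun n => ?_⟩
    obtain ⟨h, e⟩ := hG n
    have key : cell L (le_ωSup (chainBase c) n) Q.fib ≫ cell L hb Q.fib ≫ Hom.fib G =
        Hom.fib (c n) := by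
      rw [← Category.assoc, cell_trans, ← e]; rfl
    exact key

/-- The least element `(⊥, ι)` where `ι : L(⊥)(Y) ⟶ X` is the unique morphism. -/
noncomputable instance homBot (P Q : Container L) : OrderBot (P ⟶ Q) where
  bot := Hom.mk ⊥ ((isInitial_bot L Q.fib).some.to P.fib)
  bot_le _ := ⟨bot_le, (isInitial_bot L Q.fib).some.hom_ext _ _⟩

theorem comp_le_comp' {P Q R : Container L} {F F' : P ⟶ Q} {G G' : Q ⟶ R} (hF : F ≤ F')
    (hG : G ≤ G') : F ≫ G ≤ F' ≫ G' := by
  obtain ⟨hF, eF⟩ := hF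
  obtain ⟨hG, eG⟩ := hG
  refine ⟨comp_le_comp hF hG, ?_⟩
  have key : cell L (comp_le_comp hF hG) R.fib ≫ eqToHom (sub_comp_obj L _ _ _) ≫
      (sub L (Hom.base F')).map (Hom.fib G') ≫ Hom.fib F' = eqToHom (sub_comp_obj L _ _ _) ≫
      (sub L (Hom.base F)).map (Hom.fib G) ≫ Hom.fib F := by
    rw [cell_comp, ← eF, ← eG]
    simp only [Category.assoc, eqToHom_trans_assoc, eqToHom_refl, Category.id_comp,
      Functor.map_comp]
    rw [cell_naturality_assoc, cell_naturality_assoc]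
  exact key

/-- The op-Grothendieck construction `Σ_C L^op` is enriched in pointed ω-cpos. -/
noncomputable instance : OmegaCpoCategory (Container L) where
  homOrder := homOrder
  homBot := homBot
  comp_continuous P Q R := ωScottContinuous.of_monotone_map_ωSup
    ⟨fun _ _ h => comp_le_comp' h.1 h.2, fun c => (eq_of_le
      (ωSup_le _ _ fun n => comp_le_comp' (le_ωSup c n).1 (le_ωSup c n).2) 
        ((OmegaCpoCategory.comp_continuous P.base Q.base R.base).map_ωSup
          ((chainBase (c.map OrderHom.fst)).zip (chainBase (c.map OrderHom.snd)))).symm).symm⟩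
  bot_comp G := (eq_of_le bot_le (OmegaCpoCategory.bot_comp (Hom.base G)).symm).symm
  comp_bot F := (eq_of_le bot_le (OmegaCpoCategory.comp_bot (Hom.base F)).symm).symm

variable [ChosenFiniteCoproducts C] [OmegaCpoCoproducts C] [PreservesFiniteProducts L]

theorem le_of_inl_inr {P Q R : Container L} {H H' : sum P Q ⟶ R}
    (hl : inl P Q ≫ H ≤ inl P Q ≫ H') (hr : inr P Q ≫ H ≤ inr P Q ≫ H') : H ≤ H' := by
  have hb : Hom.base H ≤ Hom.base H' := by
    have h := OmegaCpoCoproducts.desc_mono hl.1 hr.1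
    have e : ∀ K : sum P Q ⟶ R, IterCat.desc (Hom.base (inl P Q ≫ K)) (Hom.base (inr P Q ≫ K)) =
        Hom.base K := fun K => IterCat.sum_hom_ext (inl_desc _ _) (inr_desc _ _)
    rwa [e, e] at h
  exact ⟨hb, fib_sum_hom_ext L
    (map_cell_comp L _ hb R.fib _ _ (inl_glue L P.fib Q.fib) hl.2)
    (map_cell_comp L _ hb R.fib _ _ (inr_glue L P.fib Q.fib) hr.2)⟩

/-- The finite coproducts of `Σ_C L^op` are enriched coproducts. -/
instance : OmegaCpoCoproducts (Container L) where
  desc_mono {P Q R F F' G G'} hF hG := by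
    refine le_of_inl_inr ?_ ?_
    · exact (le_of_eq (inl_copair F G)).trans (hF.trans (le_of_eq (inl_copair F' G').symm))
    · exact (le_of_eq (inr_copair F G)).trans (hG.trans (le_of_eq (inr_copair F' G').symm))

/-- The op-fibration `Σ_C L^op ⥤ C` preserves the enriched iteration. -/
theorem omegaIter_base {P Q : Container L} (F : P ⟶ ChosenFiniteCoproducts.sum Q P) :
    Hom.base (omegaIter P Q F) = omegaIter P.base Q.base (Hom.base F) := by
  have hb : chainBase (iterChain F) = iterChain (Hom.base F) := by
    have h : ∀ n, Hom.base (loopPow F n) = loopPow (Hom.base F) n := by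
      intro n
      induction n with
      | zero => rfl
      | succ n ih =>
        change Hom.base (loopPow F n) ≫ Hom.base (loopStep F) = _ ≫ _
        rw [ih]; rfl
    refine Chain.ext (funext fun n => ?_)
    change Hom.base (loopPow F (n + 1)) ≫ _ = loopPow (Hom.base F) (n + 1) ≫ _
    rw [h]; rfl
  change _ ≫ ωSup (chainBase (iterChain F)) = _ ≫ ωSup _
  rw [hb]; rfl

end Container

end EnrichedIndexed

/-! ### The underlying iteration-extensive indexed category of an enriched one -/

section Underlying

theorem sub_desc {C : Type u} [Category.{v} C] [ChosenFiniteCoproducts C]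
    (L : Cᵒᵖ ⥤ Cat.{v₂, u₂}) [PreservesFiniteProducts L] {A B K : C} (g : B ⟶ K) (h : A ⟶ K) :
    sub L (desc g h) = (sub L g).prod' (sub L h) ⋙ glue L B A := by
  have e : sub L (desc g h) ⋙ comparison L B A = (sub L g).prod' (sub L h) := by
    change (sub L (desc g h) ⋙ sub L (inl B A)).prod' (sub L (desc g h) ⋙ sub L (inr B A)) = _
    rw [← sub_comp, ← sub_comp, inl_desc, inr_desc]
  rw [← e, Functor.assoc, comparison_glue, Functor.comp_id]

theorem fibLift_eq {C : Type u} [Category.{v} C] [ChosenFiniteCoproducts C]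
    (L : Cᵒᵖ ⥤ Cat.{v₂, u₂}) [PreservesFiniteProducts L] {B A : C}
    {Z : L.obj (op (sum B A))} {Y : L.obj (op B)} {X X' : L.obj (op A)}
    (e : Z = (glue L B A).obj (Y, X')) (k : X' ⟶ X)
    (h₁ : (sub L (inl B A)).obj Z = Y) (h₂ : (sub L (inr B A)).obj Z = X') :
    fibLift L (Z' := (glue L B A).obj (Y, X))
      (eqToHom h₁ ≫ eqToHom (inl_glue L Y X).symm)
      (eqToHom h₂ ≫ k ≫ eqToHom (inr_glue L Y X).symm) =
    eqToHom e ≫ (glue L B A).map (Prod.mkHom (𝟙 Y) k) := by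
  subst e
  refine fib_sum_hom_ext L ?_ ?_
  · rw [inl_fibLift, eqToHom_refl, Category.id_comp, inl_glue_map]
    simp
  · rw [inr_fibLift, eqToHom_refl, Category.id_comp, inr_glue_map]

/-- The second component of `[id, (h, k)] ∘ (f, φ)`, up to identities. -/
theorem fix_fib_aux {C : Type u} [Category.{v} C] [ChosenFiniteCoproducts C]
    (L : Cᵒᵖ ⥤ Cat.{v₂, u₂}) [PreservesFiniteProducts L] {A B : C}
    (f : A ⟶ sum B A) (h : A ⟶ B) {Y : L.obj (op B)} {X : L.obj (op A)}
    (φ : (sub L f).obj ((glue L B A).obj (Y, X)) ⟶ X) (k : (sub L h).obj Y ⟶ X)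
    (h₁ : (sub L (inl B A)).obj ((sub L (desc (𝟙 B) h)).obj Y) = (sub L (𝟙 B)).obj Y)
    (h₁' : (sub L (𝟙 B)).obj Y = Y)
    (h₂ : (sub L (inr B A)).obj ((sub L (desc (𝟙 B) h)).obj Y) = (sub L h).obj Y)
    (e : f ≫ desc (𝟙 B) h = h)
    (e' : (sub L f).obj ((glue L B A).obj (Y, (sub L h).obj Y)) = (sub L h).obj Y) :
    eqToHom (sub_comp_obj L f (desc (𝟙 B) h) Y) ≫ (sub L f).map
      (fibLift L (Z' := (glue L B A).obj (Y, X))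
        (eqToHom h₁ ≫ eqToHom h₁' ≫ eqToHom (inl_glue L Y X).symm)
        (eqToHom h₂ ≫ k ≫ eqToHom (inr_glue L Y X).symm)) ≫ φ =
      eqToHom (by rw [e]) ≫ eqToHom e'.symm ≫
        (sub L f).map ((glue L B A).map (Prod.mkHom (𝟙 Y) k)) ≫ φ := by
  have ez : (sub L (desc (𝟙 B) h)).obj Y = (glue L B A).obj (Y, (sub L h).obj Y) :=
    fib_sum_ext L ((h₁.trans h₁').trans (inl_glue L _ _).symm) (h₂.trans (inr_glue L _ _).symm)
  have key := fibLift_eq L ez k (h₁.trans h₁') h₂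
  rw [← eqToHom_trans h₁ h₁', Category.assoc] at key
  rw [key]
  simp [eqToHom_map]

variable {C : Type u} [Category.{v} C] [OmegaCpoCategory C] [ChosenFiniteCoproducts C]
  [OmegaCpoCoproducts C] (L : Cᵒᵖ ⥤ Cat.{v₂, u₂}) [PreservesFiniteProducts L]

/-- `L(iter f) = L(f) ∘ S ∘ (id, L(iter f))`. -/
theorem sub_omegaIter {A B : C} (f : A ⟶ sum B A) :
    sub L (omegaIter A B f) =
      (𝟭 _).prod' (sub L (omegaIter A B f)) ⋙ glue L B A ⋙ sub L f := by
  conv_lhs => rw [← omegaIter_fix, sub_comp, sub_desc, sub_id]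
  rfl

theorem sub_omegaIter_obj {A B : C} (f : A ⟶ sum B A) (Y : L.obj (op B)) :
    (sub L f).obj ((glue L B A).obj (Y, (sub L (omegaIter A B f)).obj Y)) =
      (sub L (omegaIter A B f)).obj Y :=
  (Functor.congr_obj (sub_omegaIter L f) Y).symm

theorem sub_omegaIter_map {A B : C} (f : A ⟶ sum B A) {Y Y' : L.obj (op B)} (y : Y ⟶ Y') :
    (sub L f).map ((glue L B A).map (Prod.mkHom y ((sub L (omegaIter A B f)).map y))) ≫
      eqToHom (sub_omegaIter_obj L f Y') =
    eqToHom (sub_omegaIter_obj L f Y) ≫ (sub L (omegaIter A B f)).map y := by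
  have h : (sub L (omegaIter A B f)).map y = eqToHom (sub_omegaIter_obj L f Y).symm ≫
      (sub L f).map ((glue L B A).map (Prod.mkHom y ((sub L (omegaIter A B f)).map y))) ≫
      eqToHom (sub_omegaIter_obj L f Y') := Functor.congr_hom (sub_omegaIter L f) y
  rw [← cancel_epi (eqToHom (sub_omegaIter_obj L f Y).symm), ← h]
  simp

/-- The algebra structure on `L(iter f)(Y)` given by the identity
`L(f)(S(Y, L(iter f)(Y))) = L(iter f)(Y)`. -/
noncomputable def iterAlgebra {A B : C} (f : A ⟶ sum B A) (Y : L.obj (op B)) :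
    Endofunctor.Algebra (section₂ (glue L B A ⋙ sub L f) Y) where
  a := (sub L (omegaIter A B f)).obj Y
  str := eqToHom (sub_omegaIter_obj L f Y)

theorem eqToHom_comp_comp_iff {D : Type u₁} [Category.{v₁} D] {p q r x : D} (h : p = q)
    (h' : q = r) (m : r ⟶ x) (k : q ⟶ x) :
    eqToHom h ≫ eqToHom h' ≫ m = eqToHom h ≫ k ↔ m = eqToHom h'.symm ≫ k := by
  subst h h'; simp

/-- Algebra morphisms out of `L(iter f)(Y)` are the second components of fixed points. -/
theorem fix_iff {P Q : Container L} (F : P ⟶ Container.sum Q P)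
    (k : (sub L (omegaIter _ _ (Container.Hom.base F))).obj Q.fib ⟶ P.fib) :
    F ≫ Container.copair (𝟙 Q) (Container.Hom.mk (omegaIter _ _ (Container.Hom.base F)) k) =
      Container.Hom.mk (omegaIter _ _ (Container.Hom.base F)) k ↔
    (sub L (Container.Hom.base F)).map ((glue L Q.base P.base).map (Prod.mkHom (𝟙 Q.fib) k)) ≫
      Container.Hom.fib F = eqToHom (sub_omegaIter_obj L (Container.Hom.base F) Q.fib) ≫ k := by
  have e := omegaIter_fix (Container.Hom.base F)
  have e' := sub_omegaIter_obj L (Container.Hom.base F) Q.fib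
  have aux := fix_fib_aux L (Container.Hom.base F) _ (Container.Hom.fib F) k
    (by rw [← sub_comp_obj, inl_desc]) (sub_id_obj L _) (by rw [← sub_comp_obj, inr_desc]) e e'
  have hp : (sub L (Container.Hom.base F ≫ desc (𝟙 Q.base)
      (omegaIter _ _ (Container.Hom.base F)))).obj Q.fib =
      (sub L (omegaIter _ _ (Container.Hom.base F))).obj Q.fib := by rw [e]
  have iff := eqToHom_comp_comp_iff hp e'.symm
    ((sub L (Container.Hom.base F)).map ((glue L Q.base P.base).map (Prod.mkHom (𝟙 Q.fib) k)) ≫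
      Container.Hom.fib F) k
  exact ⟨fun h => iff.1 (aux.symm.trans (Container.Hom.fib_eq_of_eq h)),
    fun h => Container.hom_ext e (aux.trans (iff.2 h))⟩

section

variable [OmegaCpoIndexed L]

theorem iterAlgebra_isInitial {A B : C} (f : A ⟶ sum B A) (Y : L.obj (op B)) :
    Nonempty (IsInitial (iterAlgebra L f Y)) := by
  have key : ∀ W : Endofunctor.Algebra (section₂ (glue L B A ⋙ sub L f) Y),
      Nonempty (Unique (iterAlgebra L f Y ⟶ W)) := by
    intro W
    let P : Container L := ⟨A, W.a⟩
    let Q : Container L := ⟨B, Y⟩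
    let F : P ⟶ Container.sum Q P := Container.Hom.mk f W.str
    have hb : Container.Hom.base (omegaIter P Q F) = omegaIter A B f := Container.omegaIter_base F
    obtain ⟨k₀, hk₀⟩ : ∃ k : (sub L (omegaIter A B f)).obj Y ⟶ W.a,
        omegaIter P Q F = Container.Hom.mk (omegaIter A B f) k :=
      ⟨eqToHom (by rw [hb]) ≫ Container.Hom.fib (omegaIter P Q F),
        Container.hom_ext hb (by simp)⟩
    have h₀ := omegaIter_fix F
    rw [hk₀] at h₀
    refine ⟨⟨⟨Endofunctor.Algebra.Hom.mk k₀ ((fix_iff L F k₀).1 h₀)⟩, fun m => ?_⟩⟩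
    have hm := (fix_iff L F m.f).2 m.h
    have hle := omegaIter_le F _ (le_of_eq hm)
    have heq := Container.eq_of_le hle hb
    rw [hk₀] at heq
    exact Endofunctor.Algebra.Hom.ext (eq_of_heq (Container.Hom.mk.inj heq).2).symm
  exact ⟨IsInitial.ofUniqueHom (fun W => (key W).some.default) (fun W => (key W).some.uniq)⟩

theorem underlying_exists_mu {A B : C} (f : A ⟶ sum B A) :
    HasParamInitialAlgebra (glue L B A ⋙ sub L f) where
  hasInitial Y := (iterAlgebra_isInitial L f Y).some.hasInitial

/-- The unique isomorphism of algebras from `L(iter f)(Y)`, with the identity as its structure,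
to the initial algebra. -/
noncomputable def underlyingAlgebraIso {A B : C} (f : A ⟶ sum B A) (Y : L.obj (op B)) :
    haveI := underlying_exists_mu L f
    iterAlgebra L f Y ≅ initialAlgebra (glue L B A ⋙ sub L f) Y :=
  haveI := underlying_exists_mu L f
  (iterAlgebra_isInitial L f Y).some.uniqueUpToIso initialIsInitial

/-- The underlying iteration-extensive indexed category `(C, iter, L)` of an enriched extensive
indexed category `(C, L)`, where `iter` is the enriched iteration of `C`. -/
noncomputable def underlying : IterationExtensive (omegaIter (C := C)) L where
  exists_mu f := underlying_exists_mu L f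
  iso {A B} f :=
    haveI := underlying_exists_mu L f
    NatIso.ofComponents
      (fun Y => (Endofunctor.Algebra.forget _).mapIso (underlyingAlgebraIso L f Y))
      (fun {Y Y'} y => congrArg Endofunctor.Algebra.Hom.f
        ((iterAlgebra_isInitial L f Y).some.hom_ext
          (Endofunctor.Algebra.Hom.mk
            ((sub L (omegaIter A B f)).map y ≫ (underlyingAlgebraIso L f Y').hom.f)
            (mu_nat_aux (glue L B A ⋙ sub L f) y _ _ _ _ _ (sub_omegaIter_map L f y)
              (underlyingAlgebraIso L f Y').hom.h) :
            iterAlgebra L f Y ⟶ pullAlgebra (glue L B A ⋙ sub L f) y)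
          ((underlyingAlgebraIso L f Y).hom ≫ Endofunctor.Algebra.Hom.mk
            (fold (glue L B A ⋙ sub L f) Y (pullAlgebra (glue L B A ⋙ sub L f) y))
            (fold_str (glue L B A ⋙ sub L f) Y (pullAlgebra (glue L B A ⋙ sub L f) y)))))

end

end Underlying

end IterCat

/-! Fix `F = (f, f')` from `(A, X)` to `(B, Y) ⊔ (A, X)`, and write `h = iter f` for the enriched
iteration in the base. In the total category, consider the fixed points of the operation sending a
morphism `H` to `[id, H] ∘ F`. If the first component of `H` is `h`, the fixed point equation in the
base is already satisfied, and the equation in the fibre says exactly that the second component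
`L(h)(Y) ⟶ X` is a morphism of `H_f(Y, -)`-algebras from `L(h)(Y)`, with the identity as its
structure, to `(X, f')`. This is `fix_iff`. It also absorbs the transports along `L(h) = L(f) ∘ S ∘
(id, L(h))`, an equality of functors which is not definitional.

The fold is by construction such an algebra morphism, so the container iteration of `F` is a fixed
point. The enriched iteration of `F` is the least prefixed point (`omegaIter_le`, used in the
category of containers), so it lies below the container iteration. Both have first component `h`,
because the projection to the base preserves enriched iteration (`Container.omegaIter_base`).

The order on containers then leaves no room: `(h, k) ≤ (h, k')` means `k = k' ∘ L(h ≤ h)_Y`, and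
`L(h ≤ h)` is an identity, so `k = k'` (`Container.eq_of_le`). An inequality between morphisms with
the same first component is therefore an equality. No colimit has to be computed here: continuity
enters only through the enrichment and the least prefixed point property. The initiality of
`L(h)(Y)`, without which there would be no fold, rests on the same three facts
(`iterAlgebra_isInitial`). -/

namespace IterCat

/-! ### The container iteration as a least fixed point. -/

section ContainerIteration

variable {C : Type u} [Category.{v} C] [OmegaCpoCategory C] [ChosenFiniteCoproducts C]
  [OmegaCpoCoproducts C] (L : Cᵒᵖ ⥤ Cat.{v₂, u₂}) [OmegaCpoIndexed L] [PreservesFiniteProducts L]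

/-- The second component of the container iteration, as a morphism of algebras. -/
noncomputable def iterAlgebraFold {P Q : Container L} (F : P ⟶ Container.sum Q P) :
    iterAlgebra L (Container.Hom.base F) Q.fib ⟶ ⟨P.fib, Container.Hom.fib F⟩ :=
  haveI := underlying_exists_mu L (Container.Hom.base F)
  -- The detour through the chosen initial algebra, instead of the initiality of `iterAlgebra`
  -- itself, reproduces the composite in `containerIter`: the canonical isomorphism followed by the
  -- fold.
  (underlyingAlgebraIso L (Container.Hom.base F) Q.fib).hom ≫ initial.to _

/-- Both factors of the second component underlie algebra morphisms: the component at `Q.fib` of the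
isomorphism in `underlying` is the image of `underlyingAlgebraIso` under the forgetful functor, and
a fold is the image of the map out of the initial algebra. Composition of algebra morphisms is
composition of underlying morphisms, so everything agrees by unfolding. This form makes the algebra
square of the composite available. -/
theorem containerIter_underlying {P Q : Container L} (F : P ⟶ Container.sum Q P) :
    containerIter (underlying L) P Q F =
      Container.Hom.mk (omegaIter _ _ (Container.Hom.base F)) (iterAlgebraFold L F).f :=
  rfl

/-- The container iteration satisfies the fixed point equation. -/
theorem containerIter_fix {P Q : Container L} (F : P ⟶ Container.sum Q P) :
    F ≫ Container.copair (𝟙 Q) (containerIter (underlying L) P Q F) =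
      containerIter (underlying L) P Q F := by
  rw [containerIter_underlying]
  -- The structure map of `iterAlgebra` is the `eqToHom` on the right-hand side of `fix_iff`, so the
  -- algebra square is the required fibre equation as it stands.
  exact (fix_iff L F _).2 (iterAlgebraFold L F).h

/-- The container iteration is the enriched iteration: it is a fixed point, hence above the least
one, and both have the same first component. -/
theorem containerIter_eq_omegaIter :
    containerIter (underlying L) = omegaIter (C := Container L) := by
  funext P Q F
  -- `omegaIter_le` asks for a prefixed point with respect to `desc` in the category of containers;
  -- there `desc` unfolds to `copair`, so the fixed point equation applies directly.
  exact (Container.eq_of_le (omegaIter_le F _ (le_of_eq (containerIter_fix L F)))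
    -- The first component of the container iteration is the enriched iteration of the first
    -- component of `F` by definition, so only the other side needs an argument.
    (Container.omegaIter_base F)).symm

end ContainerIteration

/-! ### From equal iterations to an isomorphism of iterative categories. -/

/-- Equal iterations on the same category are isomorphic through the identity functor. -/
theorem exists_iso_of_iter_eq {D : Type u} [Category.{v} D] [ChosenFiniteCoproducts D]
    {i j : Iteration D} (h : i = j) :
    ∃ e : IterativeCategory.mk D i ≅ IterativeCategory.mk D j,
      e.hom.functor = 𝟭 D ∧ e.inv.functor = 𝟭 D := by
  -- The iterations are variables here, so the equality can be eliminated; this makes the two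
  -- bundled iterative categories the same object. For the two concrete iterations neither side
  -- would be a variable.
  subst h
  exact ⟨Iso.refl _, rfl, rfl⟩

end IterCat

/-- The second conjunct is a formal consequence of the first. Requiring the underlying functors to
be identities is what makes it as strong as the first: a bare isomorphism could relate different
iterations through a nontrivial automorphism of the category. -/
theorem mainTheorem3 {C : Type u} [Category.{v} C] [IterCat.OmegaCpoCategory C]
    [IterCat.ChosenFiniteCoproducts C] [IterCat.OmegaCpoCoproducts C]
    (L : Cᵒᵖ ⥤ Cat.{v₂, u₂}) [IterCat.OmegaCpoIndexed L] [PreservesFiniteProducts L] :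
    IterCat.containerIter (IterCat.underlying L) =
        IterCat.omegaIter (C := IterCat.Container L) ∧
      ∃ e : IterCat.IterativeCategory.mk (IterCat.Container L)
            (IterCat.containerIter (IterCat.underlying L)) ≅
          IterCat.IterativeCategory.mk (IterCat.Container L)
            (IterCat.omegaIter (C := IterCat.Container L)),
        e.hom.functor = 𝟭 (IterCat.Container L) ∧
          e.inv.functor = 𝟭 (IterCat.Container L) :=
  ⟨IterCat.containerIter_eq_omegaIter L,
    IterCat.exists_iso_of_iter_eq (IterCat.containerIter_eq_omegaIter L)⟩
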